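/- Let $m\ge 1$ be a fixed integer. For each integer $N\ge 1$, let coupons be drawn independently, each draw being uniformly distributed on $N$ coupon types, and let $T_m(N)$ be the least number of draws after which each of the $N$ types has been drawn at least $m$ times. Then, for every $N\ge1$, $T_m(N)$ is almost surely finite and has a finite second moment, and, as $N\to\infty$, $$\operatorname{Var}(T_m(N))\sim \frac{\pi^2}{6}\,N^2$$ and $$\mathbb E\,T_m(N)=N\log N+(m-1)\,N\log\log N+N\bigl(\gamma-\log((m-1)!)\bigr)+o(N),$$ where $\gamma$ is the Euler–Mascheroni constant. -/

import Mathlib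

open MeasureTheory ProbabilityTheory Filter Asymptotics

/-- For a sequence of draws `x 0, x 1, x 2, …` of coupons of types in `C`, the least number `n` of
draws such that each type `c` occurs at least `m` times among the first `n` draws
(`⊤` if there is no such `n`). -/
noncomputable def collectionTime {C : Type*} [DecidableEq C] (m : ℕ) (x : ℕ → C) : ℕ∞ :=
  ⨅ (n : ℕ) (_ : ∀ c : C, m ≤ ((Finset.range n).filter (fun i => x i = c)).card), (n : ℕ∞)

/-- `X 0, X 1, …` are independent draws, each of them uniform on the `N` coupon types. -/
structure IsUniformDraws {Ω : Type*} [MeasurableSpace Ω] (μ : Measure Ω) (N : ℕ+)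
    (X : ℕ → Ω → Fin N) : Prop where
  measurable : ∀ i, Measurable (X i)
  indep : iIndepFun X μ
  uniform : ∀ (i : ℕ) (c : Fin N), μ {ω | X i ω = c} = ((N : ℕ) : ENNReal)⁻¹

/-- The random number of draws needed to collect every coupon type at least `m` times, as an
extended natural number. -/
noncomputable def drawTime {Ω : Type*} {N : ℕ+} (m : ℕ) (X : ℕ → Ω → Fin N) (ω : Ω) : ℕ∞ :=
  collectionTime m (fun i => X i ω)

/-- `drawTime` as a real random variable (the value on the event `drawTime = ⊤` is immaterial, as
this event is null for uniform draws). -/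
noncomputable def drawTimeReal {Ω : Type*} {N : ℕ+} (m : ℕ) (X : ℕ → Ω → Fin N) (ω : Ω) : ℝ :=
  ((drawTime m X ω).toNat : ℝ)

/-! Let the draws occur at the jumps of a unit rate Poisson process. The N counts at time t are then
independent Poisson variables of mean t/N, so the collection is complete by time t with probability
(1 - q(t/N))^N, where q = `erlangTail m`. As an identity of generating functions, without
constructing the process, this is `hasSum_completeWordRatio`. Integrating the complementary identity
against t^j dt, with ∫ t^(n+j) e^(-t) dt = (n+j)!, gives ∑ P(T > n) (n+j)!/n! = N^(j+1) M_j, where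
M_j = `erlangMaxMoment j m N`. The cases j = 0, 1 are the exact formulas E T = N M_0 and E T(T+1)/2
= N² M_1.

There remains the maximum of N independent Erlang variables, with mean M_0 and second moment 2 M_1.
Centred at a_N = `erlangCentre m N` it converges to the Gumbel law, because N q(a_N + x) → e^(-x).
Submultiplicativity of q yields one integrable bound for all large N (`abs_centredKernel_le`), so
mean and variance converge as well. The limits are Gumbel integrals not involving m, hence can be
read off at m = 1, where M_0 is the harmonic number H_N and 2 M_1 - M_0² = ∑_{1 ≤ k ≤ N} 1/k². They
are γ and π²/6. -/

/-! ### The Erlang tail: bounds, submultiplicativity, integrability. -/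

/-- The tail function `y ↦ ∑_{k < m} y ^ k / k! * exp (-y)` of the Erlang law of shape `m`. -/
noncomputable def erlangTail (m : ℕ) (y : ℝ) : ℝ :=
  (∑ k ∈ Finset.range m, y ^ k / (k.factorial : ℝ)) * Real.exp (-y)

lemma continuous_erlangTail (m : ℕ) : Continuous (erlangTail m) := by
  unfold erlangTail; fun_prop

lemma erlangTail_nonneg (m : ℕ) {y : ℝ} (hy : 0 ≤ y) : 0 ≤ erlangTail m y := by
  unfold erlangTail; positivity

lemma erlangTail_pos {m : ℕ} (hm : 1 ≤ m) {y : ℝ} (hy : 0 ≤ y) : 0 < erlangTail m y := by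
  refine mul_pos (Finset.sum_pos' (fun k _ => by positivity) ⟨0, Finset.mem_range.mpr hm, by simp⟩)
    (Real.exp_pos _)

lemma erlangTail_le_one (m : ℕ) {y : ℝ} (hy : 0 ≤ y) : erlangTail m y ≤ 1 := by
  have h := Real.sum_le_exp_of_nonneg hy m
  calc erlangTail m y ≤ Real.exp y * Real.exp (-y) := by unfold erlangTail; gcongr
    _ = 1 := by rw [← Real.exp_add]; simp

/-- The Erlang tail is submultiplicative. -/
lemma erlangTail_add_le (m : ℕ) {a b : ℝ} (ha : 0 ≤ a) (hb : 0 ≤ b) :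
    erlangTail m (a + b) ≤ erlangTail m a * erlangTail m b := by
  have key : ∑ k ∈ Finset.range m, (a + b) ^ k / (k.factorial : ℝ) ≤
      (∑ k ∈ Finset.range m, a ^ k / (k.factorial : ℝ)) *
        ∑ k ∈ Finset.range m, b ^ k / (k.factorial : ℝ) := by
    have h1 : ∀ k : ℕ, (a + b) ^ k / (k.factorial : ℝ) =
        ∑ i ∈ Finset.range (k + 1), a ^ i / (i.factorial : ℝ) *
          (b ^ (k - i) / ((k - i).factorial : ℝ)) := by
      intro k
      rw [add_pow, Finset.sum_div]
      refine Finset.sum_congr rfl fun i hi => ?_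
      have hik : i ≤ k := by simpa [Nat.lt_succ_iff] using hi
      rw [Nat.cast_choose ℝ hik]
      field_simp
    simp_rw [h1]
    -- The left side is now a sum over the triangle i + j < m, the right side the same nonnegative
    -- summand over the square i, j < m.
    rw [Finset.sum_range_diag_flip m
      (fun i j => a ^ i / (i.factorial : ℝ) * (b ^ j / (j.factorial : ℝ))), Finset.sum_mul_sum]
    refine Finset.sum_le_sum fun i _ => ?_
    refine Finset.sum_le_sum_of_subset_of_nonneg ?_ fun j _ _ => by positivity
    exact Finset.range_mono (Nat.sub_le _ _)
  calc erlangTail m (a + b) ≤ ((∑ k ∈ Finset.range m, a ^ k / (k.factorial : ℝ)) *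
        ∑ k ∈ Finset.range m, b ^ k / (k.factorial : ℝ)) * Real.exp (-(a + b)) := by
        unfold erlangTail; gcongr
    _ = erlangTail m a * erlangTail m b := by
        rw [neg_add, Real.exp_add]; unfold erlangTail; ring

lemma integrableOn_pow_mul_exp_neg (k : ℕ) :
    IntegrableOn (fun y : ℝ => y ^ k * Real.exp (-y)) (Set.Ioi 0) := by
  have h := Real.GammaIntegral_convergent (s := (k : ℝ) + 1) (by positivity)
  refine h.congr_fun (fun y _ => ?_) measurableSet_Ioi
  simp [mul_comm]

lemma integral_pow_mul_exp_neg (k : ℕ) :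
    ∫ y in Set.Ioi (0 : ℝ), y ^ k * Real.exp (-y) = (k.factorial : ℝ) := by
  rw [← Real.Gamma_nat_eq_factorial, Real.Gamma_eq_integral (by positivity)]
  refine setIntegral_congr_fun measurableSet_Ioi (fun y _ => ?_)
  simp [mul_comm]

lemma integrableOn_pow_mul_erlangTail (j m : ℕ) :
    IntegrableOn (fun y : ℝ => y ^ j * erlangTail m y) (Set.Ioi 0) := by
  have h : IntegrableOn (fun y : ℝ => ∑ k ∈ Finset.range m,
      (k.factorial : ℝ)⁻¹ * (y ^ (j + k) * Real.exp (-y))) (Set.Ioi 0) :=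
    integrable_finsetSum _ fun k _ => (integrableOn_pow_mul_exp_neg (j + k)).const_mul _
  refine h.congr_fun (fun y _ => ?_) measurableSet_Ioi
  simp only [erlangTail, Finset.sum_mul, Finset.mul_sum]
  refine Finset.sum_congr rfl fun k _ => ?_
  rw [pow_add]; ring

lemma integrable_comp_abs_of_integrableOn_Ioi {f : ℝ → ℝ} (hf : IntegrableOn f (Set.Ioi 0)) :
    Integrable (fun x => f |x|) := by
  have h1 : IntegrableOn (fun x => f |x|) (Set.Ioi 0) :=
    hf.congr_fun (fun x hx => by simp [abs_of_pos (show (0 : ℝ) < x from hx)]) measurableSet_Ioi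
  have h2 : IntegrableOn (fun x => f |x|) (Set.Iic 0) := by
    have hneg : MeasurableEmbedding fun x : ℝ => -x := (Homeomorph.neg ℝ).measurableEmbedding
    rw [← Measure.map_neg_eq_self (volume : Measure ℝ), hneg.integrableOn_map_iff]
    simp_rw [Function.comp_def, abs_neg, Set.neg_preimage, Set.neg_Iic,
      neg_zero]
    exact Iff.mpr integrableOn_Ici_iff_integrableOn_Ioi h1
  rw [← integrableOn_univ, ← Set.Iic_union_Ioi (a := (0 : ℝ))]
  exact h2.union h1

/-! ### The maximum of `N` Erlang variables and its centred moments. -/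

/-- The distribution function of the maximum of `N` independent Erlang variables of shape `m`. -/
noncomputable def erlangMaxCDF (m N : ℕ) (y : ℝ) : ℝ :=
  if 0 < y then (1 - erlangTail m y) ^ N else 0

lemma measurable_erlangMaxCDF (m N : ℕ) : Measurable (erlangMaxCDF m N) := by
  refine Measurable.ite measurableSet_Ioi ?_ measurable_const
  exact (((continuous_const.sub (continuous_erlangTail m)).pow N)).measurable

lemma one_sub_one_sub_erlangTail_pow_nonneg (m N : ℕ) {y : ℝ} (hy : 0 ≤ y) :
    0 ≤ 1 - (1 - erlangTail m y) ^ N := by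
  have h0 := erlangTail_nonneg m hy
  have h1 := erlangTail_le_one m hy
  have := pow_le_one₀ (n := N) (sub_nonneg.mpr h1) (by linarith)
  linarith

lemma one_sub_one_sub_erlangTail_pow_le (m N : ℕ) {y : ℝ} (hy : 0 ≤ y) :
    1 - (1 - erlangTail m y) ^ N ≤ N * erlangTail m y := by
  have h1 := erlangTail_le_one m hy
  have h := one_add_mul_le_pow (a := -erlangTail m y) (by linarith) N
  rw [← sub_eq_add_neg] at h
  linarith

/-- The moments `∫ y ^ j * (1 - F y)` over the positive half-line, with `F = erlangMaxCDF m N`. -/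
noncomputable def erlangMaxMoment (j m N : ℕ) : ℝ :=
  ∫ y in Set.Ioi (0 : ℝ), y ^ j * (1 - (1 - erlangTail m y) ^ N)

lemma integrableOn_erlangMaxMoment (j m N : ℕ) :
    IntegrableOn (fun y : ℝ => y ^ j * (1 - (1 - erlangTail m y) ^ N)) (Set.Ioi 0) := by
  refine ((integrableOn_pow_mul_erlangTail j m).const_mul (N : ℝ)).mono' ?_ ?_
  · refine Continuous.aestronglyMeasurable ?_
    have := continuous_erlangTail m
    fun_prop
  · refine (ae_restrict_iff' measurableSet_Ioi).mpr (ae_of_all _ fun y hy => ?_)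
    have hy' : (0 : ℝ) ≤ y := le_of_lt hy
    have h0 := one_sub_one_sub_erlangTail_pow_nonneg m N hy'
    have h1 := one_sub_one_sub_erlangTail_pow_le m N hy'
    rw [Real.norm_of_nonneg (by positivity)]
    calc y ^ j * (1 - (1 - erlangTail m y) ^ N) ≤ y ^ j * (N * erlangTail m y) := by gcongr
      _ = _ := by ring

/-- The difference of the distribution functions of the constant `0` and of the maximum of `N`
Erlang variables centred at `a`. -/
noncomputable def centredKernel (m N : ℕ) (a x : ℝ) : ℝ :=
  (if 0 < x then 1 else 0) - erlangMaxCDF m N (a + x)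

lemma measurable_centredKernel (m N : ℕ) (a : ℝ) : Measurable (centredKernel m N a) :=
  (Measurable.ite measurableSet_Ioi measurable_const measurable_const).sub
    ((measurable_erlangMaxCDF m N).comp (measurable_const_add a))

/-- The dominating function for the limit in `N`. For x > 0, Bernoulli's inequality and
submultiplicativity give N q(a + x) ≤ N q(a) q(x). For x ≤ 0 with a + x > 0, writing a = (a + x) +
(-x) gives 1/2 ≤ N q(a + x) q(-x), while (1 - q)^N ≤ e^(-Nq) ≤ 1/(Nq). -/
lemma abs_centredKernel_le {m N : ℕ} (hm : 1 ≤ m) {a : ℝ} (ha : 0 ≤ a)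
    (h1 : 1 / 2 ≤ N * erlangTail m a) (h2 : N * erlangTail m a ≤ 2) (x : ℝ) :
    |centredKernel m N a x| ≤ 2 * erlangTail m |x| := by
  unfold centredKernel erlangMaxCDF
  by_cases hx : 0 < x
  · have hax : 0 < a + x := by linarith
    have h3 := one_sub_one_sub_erlangTail_pow_nonneg m N hax.le
    have h4 := one_sub_one_sub_erlangTail_pow_le m N hax.le
    rw [if_pos hx, if_pos hax, abs_of_nonneg h3, abs_of_pos hx]
    have h5 := erlangTail_add_le m ha hx.le
    have h6 := erlangTail_nonneg m hx.le
    calc _ ≤ (N : ℝ) * (erlangTail m a * erlangTail m x) := h4.trans (by gcongr)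
      _ = (N * erlangTail m a) * erlangTail m x := by ring
      _ ≤ _ := by gcongr
  · push Not at hx
    rw [if_neg hx.not_gt, zero_sub, abs_neg, abs_of_nonpos hx]
    have h6 := erlangTail_pos hm (neg_nonneg.mpr hx)
    split_ifs with hax
    · set q := erlangTail m (a + x) with hq
      have hq1 : q ≤ 1 := erlangTail_le_one m hax.le
      have h5 := erlangTail_add_le m hax.le (neg_nonneg.mpr hx)
      rw [add_neg_cancel_right, ← hq] at h5
      have h7 : 1 / 2 ≤ N * q * erlangTail m (-x) := by
        calc (1 / 2 : ℝ) ≤ N * erlangTail m a := h1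
          _ ≤ N * (q * erlangTail m (-x)) := by gcongr
          _ = _ := by ring
      have h8 : 0 < N * q := by
        by_contra hcon
        push Not at hcon
        nlinarith
      rw [abs_of_nonneg (pow_nonneg (by linarith) N)]
      have h9 : (1 - q) ^ N ≤ Real.exp (-(N * q)) := by
        calc (1 - q) ^ N ≤ (Real.exp (-q)) ^ N := by
              have := Real.add_one_le_exp (-q)
              exact pow_le_pow_left₀ (by linarith) (by linarith) N
          _ = _ := by rw [← Real.exp_nat_mul]; ring_nf
      have h10 : Real.exp (-(N * q)) ≤ (N * q)⁻¹ := by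
        rw [Real.exp_neg]
        gcongr
        linarith [Real.add_one_le_exp (N * q)]
      refine h9.trans (h10.trans ?_)
      rw [inv_le_iff_one_le_mul₀ h8]
      linarith
    · simp [h6.le]

/-- For Y the maximum, these are E(Y - a) and E(Y - a)², obtained by integrating a difference of
distribution functions against 1 and 2x. -/
lemma integral_centredKernel (m N : ℕ) {a : ℝ} (ha : 0 ≤ a) :
    ∫ x, centredKernel m N a x = erlangMaxMoment 0 m N - a ∧
    ∫ x, 2 * x * centredKernel m N a x =
      2 * erlangMaxMoment 1 m N - 2 * a * erlangMaxMoment 0 m N + a ^ 2 := by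
  -- After the shift x = y - a, the step at y = a is the step at 0 minus the indicator of (0, a].
  have hK : ∀ y : ℝ, centredKernel m N a (-a + y) =
      (Set.Ioi (0 : ℝ)).indicator (fun y => 1 - (1 - erlangTail m y) ^ N) y -
        (Set.Ioc (0 : ℝ) a).indicator (fun _ => 1) y := by
    intro y
    unfold centredKernel erlangMaxCDF
    rw [add_neg_cancel_left]
    by_cases h1 : 0 < y
    · by_cases h2 : a < y
      · have h3 : y ∉ Set.Ioc 0 a := fun h => h2.not_ge h.2
        have h4 : 0 < -a + y := by linarith
        simp [h1, h3, h4]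
      · have h3 : y ∈ Set.Ioc 0 a := ⟨h1, not_lt.mp h2⟩
        have h4 : ¬ 0 < -a + y := by linarith
        simp [h1, h3, h4]
    · have h3 : y ∉ Set.Ioc 0 a := fun h => h1 h.1
      have h4 : ¬ 0 < -a + y := by linarith
      simp [h1, h3, h4]
  have i0 : IntegrableOn (fun y : ℝ => 1 - (1 - erlangTail m y) ^ N) (Set.Ioi 0) := by
    simpa using integrableOn_erlangMaxMoment 0 m N
  have i1 : IntegrableOn (fun y : ℝ => y * (1 - (1 - erlangTail m y) ^ N)) (Set.Ioi 0) := by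
    simpa using integrableOn_erlangMaxMoment 1 m N
  have e0 : ∫ y in Set.Ioi (0 : ℝ), (1 - (1 - erlangTail m y) ^ N) = erlangMaxMoment 0 m N := by
    simp [erlangMaxMoment]
  have e1 : ∫ y in Set.Ioi (0 : ℝ), y * (1 - (1 - erlangTail m y) ^ N) =
      erlangMaxMoment 1 m N := by
    simp [erlangMaxMoment]
  constructor
  · rw [← integral_add_left_eq_self _ (-a)]
    simp_rw [hK]
    rw [integral_sub, integral_indicator measurableSet_Ioi, integral_indicator measurableSet_Ioc,
      e0]
    · simp [ha]
    · exact i0.integrable_indicator measurableSet_Ioi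
    · exact IntegrableOn.integrable_indicator (by simp) measurableSet_Ioc
  · rw [← integral_add_left_eq_self _ (-a)]
    have hK2 : ∀ y : ℝ, 2 * (-a + y) * centredKernel m N a (-a + y) =
      (Set.Ioi (0 : ℝ)).indicator (fun y => 2 * (y * (1 - (1 - erlangTail m y) ^ N)) -
        2 * a * (1 - (1 - erlangTail m y) ^ N)) y -
        (Set.Ioc (0 : ℝ) a).indicator (fun y => 2 * y - 2 * a) y := by
      intro y
      rw [hK]
      by_cases h1 : y ∈ Set.Ioi (0 : ℝ) <;> by_cases h2 : y ∈ Set.Ioc (0 : ℝ) a <;>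
        simp only [h1, h2, Set.indicator_of_mem, Set.indicator_of_notMem, not_false_eq_true] <;>
        ring
    simp_rw [hK2]
    have i2 : IntegrableOn (fun y : ℝ => 2 * y - 2 * a) (Set.Ioc 0 a) := by
      refine (Continuous.integrableOn_Icc (a := 0) (b := a) ?_).mono_set Set.Ioc_subset_Icc_self
      fun_prop
    have i3 : ∫ y in (0 : ℝ)..a, (2 * y - 2 * a) = -a ^ 2 := by
      rw [intervalIntegral.integral_sub (Continuous.intervalIntegrable (by fun_prop) _ _)
        (Continuous.intervalIntegrable (by fun_prop) _ _), intervalIntegral.integral_const_mul,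
        integral_id, intervalIntegral.integral_const, smul_eq_mul]
      ring
    rw [integral_sub, integral_indicator measurableSet_Ioi, integral_indicator measurableSet_Ioc,
      integral_sub (i1.const_mul _) (i0.const_mul _), integral_const_mul, integral_const_mul, e0,
      e1, ← intervalIntegral.integral_of_le ha, i3]
    · ring
    · exact IntegrableOn.integrable_indicator ((i1.const_mul _).sub (i0.const_mul _))
        measurableSet_Ioi
    · exact i2.integrable_indicator measurableSet_Ioc

/-! ### Extreme value asymptotics and the Gumbel limit. -/

/-- The centring `log N + (m - 1) * log (log N) - log (m - 1)!` of the maximum of `N` Erlang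
variables of shape `m`. -/
noncomputable def erlangCentre (m N : ℕ) : ℝ :=
  Real.log N + ((m : ℝ) - 1) * Real.log (Real.log N) - Real.log ((m - 1).factorial : ℝ)

lemma tendsto_log_natCast_atTop : Tendsto (fun N : ℕ => Real.log (N : ℝ)) atTop atTop :=
  Real.tendsto_log_atTop.comp tendsto_natCast_atTop_atTop

lemma tendsto_log_log_div_log :
    Tendsto (fun N : ℕ => Real.log (Real.log (N : ℝ)) / Real.log N) atTop (nhds 0) :=
  (Real.isLittleO_log_id_atTop.tendsto_div_nhds_zero).comp tendsto_log_natCast_atTop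

lemma tendsto_erlangCentre_add_div_log (m : ℕ) (x : ℝ) :
    Tendsto (fun N : ℕ => (erlangCentre m N + x) / Real.log N) atTop (nhds 1) := by
  have h1 : Tendsto (fun N : ℕ => (1 : ℝ) +
      ((m : ℝ) - 1) * (Real.log (Real.log (N : ℝ)) / Real.log N) +
      (x - Real.log ((m - 1).factorial : ℝ)) / Real.log N) atTop
      (nhds (1 + ((m : ℝ) - 1) * 0 + 0)) :=
    (tendsto_const_nhds.add (tendsto_log_log_div_log.const_mul _)).add
      (tendsto_log_natCast_atTop.const_div_atTop _)
  simp only [mul_zero, add_zero] at h1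
  refine h1.congr' ?_
  filter_upwards [tendsto_log_natCast_atTop.eventually_gt_atTop 0] with N hN
  unfold erlangCentre
  field_simp
  ring

lemma tendsto_erlangCentre_atTop (m : ℕ) : Tendsto (erlangCentre m) atTop atTop := by
  have h := (tendsto_erlangCentre_add_div_log m 0).pos_mul_atTop one_pos tendsto_log_natCast_atTop
  refine h.congr' ?_
  filter_upwards [tendsto_log_natCast_atTop.eventually_gt_atTop 0] with N hN
  field_simp
  ring

lemma exp_neg_erlangCentre {m N : ℕ} (hm : 1 ≤ m) (hN : 0 < Real.log N) :
    Real.exp (-erlangCentre m N) = ((m - 1).factorial : ℝ) / (N * Real.log N ^ (m - 1)) := by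
  have hN0 : (0 : ℝ) < N := by
    rcases Nat.eq_zero_or_pos N with h | h
    · simp [h] at hN
    · exact_mod_cast h
  have hf : (0 : ℝ) < ((m - 1).factorial : ℝ) := by positivity
  have hm' : ((m : ℝ) - 1) = ((m - 1 : ℕ) : ℝ) := by rw [Nat.cast_sub hm]; simp
  rw [← Real.exp_log (show 0 < ((m - 1).factorial : ℝ) / (N * Real.log N ^ (m - 1)) by positivity),
    Real.log_div hf.ne' (by positivity), Real.log_mul hN0.ne' (by positivity), Real.log_pow]
  unfold erlangCentre
  rw [hm']
  congr 1
  ring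

/-- Extreme value asymptotics of the Erlang tail. -/
lemma tendsto_mul_erlangTail {m : ℕ} (hm : 1 ≤ m) (x : ℝ) :
    Tendsto (fun N : ℕ => (N : ℝ) * erlangTail m (erlangCentre m N + x)) atTop
      (nhds (Real.exp (-x))) := by
  obtain ⟨r, rfl⟩ : ∃ r, m = r + 1 := ⟨m - 1, by omega⟩
  -- With a = `erlangCentre (r + 1) N` and L = log N, N q(a + x) equals e^(-x) r! ∑ ((a + x)/L)^k
  -- L^(-(r-k))/k!. Since (a + x)/L → 1, only the term k = r survives.
  have hterm : ∀ k ∈ Finset.range (r + 1), Tendsto (fun N : ℕ =>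
      ((erlangCentre (r + 1) N + x) / Real.log N) ^ k * (Real.log N)⁻¹ ^ (r - k) /
        (k.factorial : ℝ)) atTop (nhds (1 ^ k * 0 ^ (r - k) / (k.factorial : ℝ))) := fun k _ =>
    (((tendsto_erlangCentre_add_div_log _ x).pow k).mul
      ((tendsto_inv_atTop_zero.comp tendsto_log_natCast_atTop).pow (r - k))).div_const _
  have hsum := ((tendsto_finsetSum _ hterm).const_mul (r.factorial : ℝ)).const_mul (Real.exp (-x))
  have hval : Real.exp (-x) * ((r.factorial : ℝ) *
      ∑ k ∈ Finset.range (r + 1), (1 : ℝ) ^ k * 0 ^ (r - k) / (k.factorial : ℝ)) =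
      Real.exp (-x) := by
    rw [Finset.sum_range_succ, Finset.sum_eq_zero]
    · have : (r.factorial : ℝ) ≠ 0 := by positivity
      simp [this]
    · intro k hk
      have : r - k ≠ 0 := by have := Finset.mem_range.mp hk; omega
      simp [this]
  rw [hval] at hsum
  refine hsum.congr' ?_
  filter_upwards [tendsto_log_natCast_atTop.eventually_gt_atTop 0] with N hN
  have hN0 : (N : ℝ) ≠ 0 := by
    rintro h
    simp [h] at hN
  rw [erlangTail, neg_add, Real.exp_add, exp_neg_erlangCentre hm hN, Nat.add_sub_cancel]
  have : ∀ k ∈ Finset.range (r + 1),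
      ((erlangCentre (r + 1) N + x) / Real.log N) ^ k * (Real.log N)⁻¹ ^ (r - k) /
        (k.factorial : ℝ) =
      (erlangCentre (r + 1) N + x) ^ k / (k.factorial : ℝ) * (Real.log N ^ r)⁻¹ := by
    intro k hk
    have hkr : k ≤ r := Nat.lt_succ_iff.mp (Finset.mem_range.mp hk)
    have hs : Real.log N ^ r = Real.log N ^ k * Real.log N ^ (r - k) := by
      rw [← pow_add, Nat.add_sub_cancel' hkr]
    rw [hs, div_pow, inv_pow]
    field_simp
  rw [Finset.sum_congr rfl this, ← Finset.sum_mul]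
  field_simp

/-- If N q_N → e^(-x), then (1 - q_N)^N → exp(-e^(-x)), the Gumbel distribution function. -/
lemma tendsto_centredKernel {m : ℕ} (hm : 1 ≤ m) (x : ℝ) :
    Tendsto (fun N : ℕ => centredKernel m N (erlangCentre m N) x) atTop
      (nhds ((if 0 < x then 1 else 0) - Real.exp (-Real.exp (-x)))) := by
  refine tendsto_const_nhds.sub ?_
  have h := Real.tendsto_one_add_pow_exp_of_tendsto
    (g := fun N : ℕ => -erlangTail m (erlangCentre m N + x)) (t := -Real.exp (-x))
    (by simpa using (tendsto_mul_erlangTail hm x).neg)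
  refine h.congr' ?_
  filter_upwards [(tendsto_erlangCentre_atTop m).eventually_gt_atTop (-x)] with N hN
  rw [erlangMaxCDF, if_pos (by linarith), sub_eq_add_neg]

lemma tendsto_integral_pow_mul_centredKernel {m : ℕ} (hm : 1 ≤ m) (j : ℕ) :
    Tendsto (fun N : ℕ => ∫ x, x ^ j * centredKernel m N (erlangCentre m N) x) atTop
      (nhds (∫ x, x ^ j * ((if 0 < x then 1 else 0) - Real.exp (-Real.exp (-x))))) := by
  refine tendsto_integral_filter_of_dominated_convergence
    (fun x => |x| ^ j * (2 * erlangTail m |x|)) ?_ ?_ ?_ ?_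
  · refine Eventually.of_forall fun N => Measurable.aestronglyMeasurable ?_
    exact (measurable_id.pow_const j).mul (measurable_centredKernel _ _ _)
  -- At x = 0 the limit of N q(a_N) is 1, so the hypotheses 1/2 ≤ N q(a_N) ≤ 2 of the domination
  -- bound hold eventually.
  · have h := tendsto_mul_erlangTail hm 0
    simp only [add_zero, neg_zero, Real.exp_zero] at h
    filter_upwards [(tendsto_erlangCentre_atTop m).eventually_ge_atTop 0,
      h.eventually_const_le (show (1 / 2 : ℝ) < 1 by norm_num),
      h.eventually_le_const (show (1 : ℝ) < 2 by norm_num)] with N h0 h1 h2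
    refine ae_of_all _ fun x => ?_
    rw [Real.norm_eq_abs, abs_mul, abs_pow]
    exact mul_le_mul_of_nonneg_left (abs_centredKernel_le hm h0 h1 h2 x) (by positivity)
  · refine integrable_comp_abs_of_integrableOn_Ioi
      (f := fun y => y ^ j * (2 * erlangTail m y)) ?_
    refine IntegrableOn.congr_fun ((integrableOn_pow_mul_erlangTail j m).const_mul 2)
      (fun y _ => ?_) measurableSet_Ioi
    ring
  · exact ae_of_all _ fun x => (tendsto_centredKernel hm x).const_mul _

/-- The centred moments converge, and the limits do not depend on `m`. -/
lemma tendsto_erlangMaxMoment_sub_centre {m : ℕ} (hm : 1 ≤ m) :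
    Tendsto (fun N : ℕ => erlangMaxMoment 0 m N - erlangCentre m N) atTop
      (nhds (∫ x : ℝ, ((if 0 < x then 1 else 0) - Real.exp (-Real.exp (-x))))) ∧
    Tendsto (fun N : ℕ => 2 * erlangMaxMoment 1 m N - erlangMaxMoment 0 m N ^ 2) atTop
      (nhds (2 * (∫ x : ℝ, x * ((if 0 < x then 1 else 0) - Real.exp (-Real.exp (-x)))) -
        (∫ x : ℝ, ((if 0 < x then 1 else 0) - Real.exp (-Real.exp (-x)))) ^ 2)) := by
  have h0 := tendsto_integral_pow_mul_centredKernel hm 0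
  have h1 := tendsto_integral_pow_mul_centredKernel hm 1
  simp only [pow_zero, one_mul] at h0
  simp only [pow_one] at h1
  have hpos := (tendsto_erlangCentre_atTop m).eventually_ge_atTop 0
  constructor
  · refine h0.congr' ?_
    filter_upwards [hpos] with N hN
    exact (integral_centredKernel m N hN).1
  -- The variance is unchanged by centring: 2 M_1 - M_0² = (2 M_1 - 2 a M_0 + a²) - (M_0 - a)².
  · refine ((h1.const_mul 2).sub (h0.pow 2)).congr' ?_
    filter_upwards [hpos] with N hN
    have h2 := (integral_centredKernel m N hN).2
    simp_rw [mul_assoc] at h2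
    rw [integral_const_mul] at h2
    rw [h2, (integral_centredKernel m N hN).1]
    ring

/-! ### Exact moments in the exponential case `m = 1`. -/

lemma erlangTail_one (y : ℝ) : erlangTail 1 y = Real.exp (-y) := by
  simp [erlangTail]

lemma hasDerivAt_one_sub_exp_neg_pow (N : ℕ) (y : ℝ) :
    HasDerivAt (fun y : ℝ => (1 - Real.exp (-y)) ^ (N + 1))
      ((N + 1) * (Real.exp (-y) * (1 - Real.exp (-y)) ^ N)) y := by
  have h1 : HasDerivAt (fun y : ℝ => 1 - Real.exp (-y)) (Real.exp (-y)) y := by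
    have := ((hasDerivAt_neg y).exp).const_sub 1
    simpa using this
  have h2 := h1.pow (N + 1)
  simp only [Nat.add_sub_cancel] at h2
  refine h2.congr_deriv ?_
  push_cast
  ring

lemma integrableOn_pow_mul_exp_neg_mul_one_sub_exp_neg_pow (j N : ℕ) :
    IntegrableOn (fun y : ℝ => y ^ j * (Real.exp (-y) * (1 - Real.exp (-y)) ^ N)) (Set.Ioi 0) := by
  refine (integrableOn_pow_mul_exp_neg j).mono' ?_ ?_
  · exact Continuous.aestronglyMeasurable (by fun_prop)
  · refine (ae_restrict_iff' measurableSet_Ioi).mpr (ae_of_all _ fun y hy => ?_)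
    have hy' : (0 : ℝ) ≤ y := le_of_lt hy
    have h1 : Real.exp (-y) ≤ 1 := Real.exp_le_one_iff.mpr (by linarith)
    have h0 : 0 ≤ 1 - Real.exp (-y) := by linarith
    rw [Real.norm_of_nonneg (by positivity)]
    have h2 : (1 - Real.exp (-y)) ^ N ≤ 1 :=
      pow_le_one₀ h0 (by linarith [Real.exp_pos (-y)])
    calc _ ≤ y ^ j * (Real.exp (-y) * 1) := by gcongr
      _ = _ := by ring

lemma integral_exp_neg_mul_one_sub_exp_neg_pow (N : ℕ) :
    ∫ y in Set.Ioi (0 : ℝ), Real.exp (-y) * (1 - Real.exp (-y)) ^ N = ((N : ℝ) + 1)⁻¹ := by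
  have hlim : Tendsto (fun y : ℝ => (1 - Real.exp (-y)) ^ (N + 1)) atTop (nhds 1) := by
    simpa using ((tendsto_const_nhds (x := (1 : ℝ))).sub
      Real.tendsto_exp_neg_atTop_nhds_zero).pow (N + 1)
  have hint : IntegrableOn (fun y : ℝ => ((N : ℝ) + 1) *
      (Real.exp (-y) * (1 - Real.exp (-y)) ^ N)) (Set.Ioi 0) := by
    have := integrableOn_pow_mul_exp_neg_mul_one_sub_exp_neg_pow 0 N
    simp only [pow_zero, one_mul] at this
    exact this.const_mul _
  have h := integral_Ioi_of_hasDerivAt_of_tendsto' (a := 0)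
    (fun y _ => hasDerivAt_one_sub_exp_neg_pow N y) hint hlim
  rw [integral_const_mul] at h
  simp only [neg_zero, Real.exp_zero, sub_self, ne_eq, Nat.add_eq_zero_iff, one_ne_zero, and_false,
    not_false_eq_true, zero_pow, sub_zero] at h
  exact eq_inv_of_mul_eq_one_right h

/-- With p = 1 - e^(-y), p^N - p^(N+1) = e^(-y) p^N. This drives the inductions on `N` for both
moments. -/
lemma erlangMaxMoment_one_succ_sub (j N : ℕ) :
    erlangMaxMoment j 1 (N + 1) - erlangMaxMoment j 1 N =
      ∫ y in Set.Ioi (0 : ℝ), y ^ j * (Real.exp (-y) * (1 - Real.exp (-y)) ^ N) := by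
  unfold erlangMaxMoment
  rw [← integral_sub (integrableOn_erlangMaxMoment j 1 (N + 1))
    (integrableOn_erlangMaxMoment j 1 N)]
  congr 1
  ext y
  rw [erlangTail_one]
  ring

lemma erlangMaxMoment_zero_one (N : ℕ) : erlangMaxMoment 0 1 N = (harmonic N : ℝ) := by
  induction N with
  | zero => simp [erlangMaxMoment]
  | succ N ih =>
    have h := erlangMaxMoment_one_succ_sub 0 N
    simp only [pow_zero, one_mul] at h
    rw [integral_exp_neg_mul_one_sub_exp_neg_pow] at h
    rw [harmonic_succ]
    push_cast
    linarith

/-- Integration by parts: y (1 - (1 - e^(-y))^(N+1)) vanishes at 0 and at infinity, so the integral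
of its derivative is zero. -/
lemma integral_mul_exp_neg_mul_one_sub_exp_neg_pow (N : ℕ) :
    ∫ y in Set.Ioi (0 : ℝ), y * (Real.exp (-y) * (1 - Real.exp (-y)) ^ N) =
      (harmonic (N + 1) : ℝ) / ((N : ℝ) + 1) := by
  have i1 : IntegrableOn (fun y : ℝ => 1 - (1 - Real.exp (-y)) ^ (N + 1)) (Set.Ioi 0) := by
    simpa [erlangTail_one] using integrableOn_erlangMaxMoment 0 1 (N + 1)
  have e1 : ∫ y in Set.Ioi (0 : ℝ), (1 - (1 - Real.exp (-y)) ^ (N + 1)) =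
      (harmonic (N + 1) : ℝ) := by
    simpa [erlangTail_one, erlangMaxMoment] using erlangMaxMoment_zero_one (N + 1)
  have i2 : IntegrableOn (fun y : ℝ => y * (Real.exp (-y) * (1 - Real.exp (-y)) ^ N))
      (Set.Ioi 0) := by
    simpa using integrableOn_pow_mul_exp_neg_mul_one_sub_exp_neg_pow 1 N
  have hlim : Tendsto (fun y : ℝ => y * (1 - (1 - Real.exp (-y)) ^ (N + 1))) atTop (nhds 0) := by
    have hup : Tendsto (fun y : ℝ => ((N + 1 : ℕ) : ℝ) * (y ^ 1 * Real.exp (-y))) atTop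
        (nhds 0) := by
      simpa using (Real.tendsto_pow_mul_exp_neg_atTop_nhds_zero 1).const_mul ((N + 1 : ℕ) : ℝ)
    refine tendsto_of_tendsto_of_tendsto_of_le_of_le' tendsto_const_nhds hup ?_ ?_
    · filter_upwards [eventually_ge_atTop 0] with y hy
      have := one_sub_one_sub_erlangTail_pow_nonneg 1 (N + 1) hy
      rw [erlangTail_one] at this
      positivity
    · filter_upwards [eventually_ge_atTop 0] with y hy
      have := one_sub_one_sub_erlangTail_pow_le 1 (N + 1) hy
      rw [erlangTail_one] at this
      calc _ ≤ y * (((N + 1 : ℕ) : ℝ) * Real.exp (-y)) := by gcongr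
        _ = _ := by ring
  have hder : ∀ y ∈ Set.Ici (0 : ℝ), HasDerivAt
      (fun y : ℝ => y * (1 - (1 - Real.exp (-y)) ^ (N + 1)))
      ((1 - (1 - Real.exp (-y)) ^ (N + 1)) -
        ((N : ℝ) + 1) * (y * (Real.exp (-y) * (1 - Real.exp (-y)) ^ N))) y := by
    intro y _
    refine ((hasDerivAt_id y).mul
      ((hasDerivAt_one_sub_exp_neg_pow N y).const_sub 1)).congr_deriv ?_
    simp only [id]
    ring
  have h := integral_Ioi_of_hasDerivAt_of_tendsto' hder (i1.sub (i2.const_mul _)) hlim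
  rw [integral_sub i1 (i2.const_mul _), integral_const_mul, e1] at h
  rw [eq_div_iff (by positivity)]
  simp only [zero_mul, sub_zero] at h
  linarith

/-- The increment is 2 H_{N+1}/(N+1) - (H_{N+1}² - H_N²) = 1/(N+1)². The term k = 0 is 0 by the
convention 1/0 = 0. -/
lemma two_mul_erlangMaxMoment_one_one_sub (N : ℕ) :
    2 * erlangMaxMoment 1 1 N - erlangMaxMoment 0 1 N ^ 2 =
      ∑ k ∈ Finset.range (N + 1), 1 / (k : ℝ) ^ 2 := by
  induction N with
  | zero => simp [erlangMaxMoment]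
  | succ N ih =>
    have h := erlangMaxMoment_one_succ_sub 1 N
    simp only [pow_one] at h
    rw [integral_mul_exp_neg_mul_one_sub_exp_neg_pow] at h
    rw [Finset.sum_range_succ, ← ih, sub_eq_iff_eq_add.mp h, erlangMaxMoment_zero_one,
      erlangMaxMoment_zero_one, harmonic_succ]
    push_cast
    field_simp
    ring

/-! ### Identification of the limits for general `m`. -/

/-- The mean of the maximum of `N` Erlang variables is `erlangCentre m N + γ + o(1)`. -/
lemma tendsto_erlangMaxMoment_zero_sub {m : ℕ} (hm : 1 ≤ m) :
    Tendsto (fun N : ℕ => erlangMaxMoment 0 m N - erlangCentre m N) atTop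
      (nhds Real.eulerMascheroniConstant) := by
  have h1 := (tendsto_erlangMaxMoment_sub_centre le_rfl).1
  have hc : ∀ N : ℕ, erlangCentre 1 N = Real.log N := fun N => by simp [erlangCentre]
  simp only [erlangMaxMoment_zero_one, hc] at h1
  -- Uniqueness of limits at m = 1 evaluates the Gumbel integral, which is the same for every m.
  rw [tendsto_nhds_unique Real.tendsto_harmonic_sub_log h1]
  exact (tendsto_erlangMaxMoment_sub_centre hm).1

/-- The variance of the maximum of `N` Erlang variables tends to `π ^ 2 / 6`. -/
lemma tendsto_two_mul_erlangMaxMoment_one_sub {m : ℕ} (hm : 1 ≤ m) :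
    Tendsto (fun N : ℕ => 2 * erlangMaxMoment 1 m N - erlangMaxMoment 0 m N ^ 2) atTop
      (nhds (Real.pi ^ 2 / 6)) := by
  have h1 := (tendsto_erlangMaxMoment_sub_centre le_rfl).2
  simp only [two_mul_erlangMaxMoment_one_one_sub] at h1
  rw [tendsto_nhds_unique (hasSum_zeta_two.tendsto_sum_nat.comp (tendsto_add_atTop_nat 1)) h1]
  exact (tendsto_erlangMaxMoment_sub_centre hm).2

/-! ### Counting words by generating functions; Poissonization. -/

/-- The total weight of the words of length `n`, where a word has the product of the weights
`g k` over all letters, `k` being the number of occurrences of the letter. -/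
lemma sum_word_prod_eq {C : Type*} [Fintype C] [DecidableEq C] (g : ℕ → ℝ) (n : ℕ) :
    ∑ f : Fin n → C, ∏ c, g (Finset.univ.filter (fun i => f i = c)).card =
      ∑ k ∈ (Finset.univ : Finset C).piAntidiag n, (Nat.multinomial Finset.univ k : ℝ) * ∏ c, g (k c) := by
  -- The linear functional sending the monomial X^k to ∏ g(k c). Evaluating it on (∑ X_c)^n,
  -- expanded over words and by the multinomial theorem, gives the two sides.
  let L : MvPolynomial C ℝ →ₗ[ℝ] ℝ :=
    (MvPolynomial.basisMonomials C ℝ).constr ℝ (fun k => ∏ c, g (k c))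
  have hL : ∀ k : C →₀ ℕ, L (MvPolynomial.monomial k 1) = ∏ c, g (k c) := by
    intro k
    have := (MvPolynomial.basisMonomials C ℝ).constr_basis ℝ (fun k => ∏ c, g (k c)) k
    simpa [L] using this
  have h1 : L ((∑ c : C, MvPolynomial.X c) ^ n) =
      ∑ f : Fin n → C, ∏ c, g (Finset.univ.filter (fun i => f i = c)).card := by
    rw [Fintype.sum_pow, map_sum]
    refine Finset.sum_congr rfl fun f _ => ?_
    have : ∏ i, (MvPolynomial.X (f i) : MvPolynomial C ℝ) =
        MvPolynomial.monomial (∑ i, Finsupp.single (f i) 1) 1 := by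
      rw [MvPolynomial.monomial_sum_one]
      rfl
    rw [this, hL]
    refine Finset.prod_congr rfl fun c _ => ?_
    rw [Finsupp.finsetSum_apply, Finset.card_filter]
    congr 1
    exact Finset.sum_congr rfl fun i _ => by rw [Finsupp.single_apply]
  have h2 : L ((∑ c : C, MvPolynomial.X c) ^ n) =
      ∑ k ∈ (Finset.univ : Finset C).piAntidiag n, (Nat.multinomial Finset.univ k : ℝ) * ∏ c, g (k c) := by
    rw [Finset.sum_pow_eq_sum_piAntidiag, map_sum]
    refine Finset.sum_congr rfl fun k _ => ?_
    have : ∏ c, (MvPolynomial.X c : MvPolynomial C ℝ) ^ k c =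
        MvPolynomial.monomial (Finsupp.equivFunOnFinite.symm k) 1 := by
      rw [MvPolynomial.monomial_eq, Finsupp.prod_fintype _ _ (by simp)]
      simp
    rw [this, ← nsmul_eq_mul, map_nsmul, hL, nsmul_eq_mul]
    simp
  rw [← h1, h2]

/-- The exponential generating function of the word weights is a power. -/
lemma sum_word_prod_div_factorial {C : Type*} [Fintype C] [DecidableEq C] (g : ℕ → ℝ) (n : ℕ) :
    (∑ f : Fin n → C, ∏ c, g (Finset.univ.filter (fun i => f i = c)).card) / (n.factorial : ℝ) =
      PowerSeries.coeff n ((PowerSeries.mk fun k => g k / (k.factorial : ℝ)) ^ Fintype.card C) := by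
  rw [sum_word_prod_eq, ← Finset.card_univ, ← Finset.prod_const, PowerSeries.coeff_prod,
    Finset.sum_div]
  refine Finset.sum_bij' (fun k _ => Finsupp.equivFunOnFinite.symm k) (fun l _ => l) ?_ ?_ ?_ ?_ ?_
  · intro k hk
    simp only [Finset.mem_piAntidiag, Finset.mem_finsuppAntidiag] at hk ⊢
    exact ⟨hk.1, Finset.subset_univ _⟩
  · intro l hl
    simp only [Finset.mem_piAntidiag, Finset.mem_finsuppAntidiag] at hl ⊢
    exact ⟨hl.1, fun _ _ => Finset.mem_univ _⟩
  · intro k _; rfl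
  · intro l _; ext; rfl
  · intro k hk
    -- The multinomial coefficient divided by n! is ∏ 1/(k c)!, which splits over the letters.
    have hs := Nat.multinomial_spec Finset.univ k
    rw [(Finset.mem_piAntidiag.mp hk).1] at hs
    simp only [PowerSeries.coeff_mk, Finsupp.equivFunOnFinite_symm_apply_apply,
      Finset.prod_div_distrib]
    have hp : (∏ c, ((k c).factorial : ℝ)) ≠ 0 :=
      Finset.prod_ne_zero_iff.mpr fun c _ => by positivity
    rw [← hs]
    push_cast
    have hm : (Nat.multinomial Finset.univ k : ℝ) ≠ 0 := by
      exact_mod_cast (Nat.multinomial_pos Finset.univ k).ne'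
    field_simp

/-- Evaluation of a power of a power series. -/
lemma PowerSeries.hasSum_coeff_pow {P : PowerSeries ℝ} {z s : ℝ}
    (h : Summable fun n => ‖PowerSeries.coeff n P * z ^ n‖)
    (hs : ∑' n, PowerSeries.coeff n P * z ^ n = s) (N : ℕ) :
    (Summable fun n => ‖PowerSeries.coeff n (P ^ N) * z ^ n‖) ∧
      ∑' n, PowerSeries.coeff n (P ^ N) * z ^ n = s ^ N := by
  induction N with
  | zero =>
    have h0 : ∀ n : ℕ, n ≠ 0 →
        PowerSeries.coeff n ((P ^ 0 : PowerSeries ℝ)) * z ^ n = 0 := by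
      intro n hn
      simp [PowerSeries.coeff_one, hn]
    constructor
    · refine summable_of_ne_finset_zero (s := {0}) fun n hn => ?_
      rw [h0 n (by simpa using hn), norm_zero]
    · rw [tsum_eq_single 0 h0]; simp
  | succ N ih =>
    have hc : ∀ n : ℕ, PowerSeries.coeff n (P ^ (N + 1)) * z ^ n =
        ∑ kl ∈ Finset.HasAntidiagonal.antidiagonal n,
          (PowerSeries.coeff kl.1 (P ^ N) * z ^ kl.1) * (PowerSeries.coeff kl.2 P * z ^ kl.2) := by
      intro n
      rw [pow_succ, PowerSeries.coeff_mul, Finset.sum_mul]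
      refine Finset.sum_congr rfl fun kl hkl => ?_
      have hkl' : kl.1 + kl.2 = n := by simpa using hkl
      rw [← hkl', pow_add]
      ring
    constructor
    · refine (summable_norm_sum_mul_antidiagonal_of_summable_norm
        (f := fun n => PowerSeries.coeff n (P ^ N) * z ^ n)
        (g := fun n => PowerSeries.coeff n P * z ^ n) ih.1 h).congr fun n => ?_
      exact congrArg _ (hc n).symm
    · have h2 := tsum_mul_tsum_eq_tsum_sum_antidiagonal_of_summable_norm
        (f := fun n => PowerSeries.coeff n (P ^ N) * z ^ n)
        (g := fun n => PowerSeries.coeff n P * z ^ n) ih.1 h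
      rw [ih.2, hs, ← pow_succ] at h2
      rw [h2]
      exact tsum_congr hc

/-- The proportion of the words of length `n` in which each of `N` letters occurs at least `m`
times. -/
noncomputable def completeWordRatio (m N n : ℕ) : ℝ :=
  ((Finset.univ.filter (fun f : Fin n → Fin N =>
    ∀ c, m ≤ (Finset.univ.filter (fun i => f i = c)).card)).card : ℝ) / (N : ℝ) ^ n

/-- With weight g(k) = 1 for k ≥ m and 0 otherwise, the weight of a word is 1 exactly when it is
complete. -/
lemma completeWordRatio_mul_pow_div_factorial (m N n : ℕ) (t : ℝ) :
    completeWordRatio m N n * (t ^ n / (n.factorial : ℝ)) =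
      PowerSeries.coeff n ((PowerSeries.mk fun k => (if m ≤ k then 1 else 0) /
        (k.factorial : ℝ)) ^ N) * (t / N) ^ n := by
  have h := sum_word_prod_div_factorial (C := Fin N) (fun k => if m ≤ k then (1 : ℝ) else 0) n
  rw [Fintype.card_fin] at h
  rw [← h, completeWordRatio, Finset.card_filter]
  push_cast
  simp_rw [Finset.prod_ite_zero, Finset.prod_const_one]
  simp only [Finset.mem_univ, true_imp_iff, div_pow]
  ring

lemma hasSum_exp_sub_partial_sum (m : ℕ) (z : ℝ) :
    HasSum (fun k : ℕ => (if m ≤ k then 1 else 0) / (k.factorial : ℝ) * z ^ k)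
      (Real.exp z - ∑ k ∈ Finset.range m, z ^ k / (k.factorial : ℝ)) := by
  have h1 : HasSum (fun k : ℕ => z ^ k / (k.factorial : ℝ)) (Real.exp z) := by
    rw [Real.exp_eq_exp_ℝ]
    exact NormedSpace.expSeries_div_hasSum_exp z
  have h2 : HasSum (fun k : ℕ => if k ∈ Finset.range m then z ^ k / (k.factorial : ℝ) else 0)
      (∑ k ∈ Finset.range m, z ^ k / (k.factorial : ℝ)) := by
    have : HasSum (fun k : ℕ => if k ∈ Finset.range m then z ^ k / (k.factorial : ℝ) else 0)
        (∑ k ∈ Finset.range m, if k ∈ Finset.range m then z ^ k / (k.factorial : ℝ) else 0) :=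
      hasSum_sum_of_ne_finset_zero fun b hb => if_neg hb
    rwa [Finset.sum_congr rfl (fun k hk => if_pos hk)] at this
  refine (h1.sub h2).congr_fun ?_
  intro k
  by_cases hk : m ≤ k
  · simp [hk, hk.not_gt]; ring
  · simp [hk, not_le.mp hk]

/-- Poissonization: the number of draws up to the time `t` of a unit rate Poisson process makes
the `N` letter counts independent. -/
lemma hasSum_completeWordRatio (m N : ℕ) (hN : N ≠ 0) {t : ℝ} (ht : 0 ≤ t) :
    HasSum (fun n : ℕ => completeWordRatio m N n * (t ^ n / (n.factorial : ℝ) * Real.exp (-t)))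
      ((1 - erlangTail m (t / N)) ^ N) := by
  have h := hasSum_exp_sub_partial_sum m (t / N)
  have hz : 0 ≤ t / N := by positivity
  have habs : Summable fun n : ℕ => ‖PowerSeries.coeff n (PowerSeries.mk fun k =>
      (if m ≤ k then 1 else 0) / (k.factorial : ℝ)) * (t / N) ^ n‖ := by
    refine h.summable.congr fun n => ?_
    rw [PowerSeries.coeff_mk, Real.norm_of_nonneg]
    split_ifs <;> positivity
  obtain ⟨h1, h2⟩ := PowerSeries.hasSum_coeff_pow habs
    (by simpa only [PowerSeries.coeff_mk] using h.tsum_eq) N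
  have h3 := (h1.of_norm.hasSum_iff.mpr h2).mul_right (Real.exp (-t))
  simp_rw [← completeWordRatio_mul_pow_div_factorial] at h3
  have hval : (Real.exp (t / N) - ∑ k ∈ Finset.range m, (t / N) ^ k / (k.factorial : ℝ)) ^ N *
      Real.exp (-t) = (1 - erlangTail m (t / N)) ^ N := by
    have hN' : (N : ℝ) ≠ 0 := by exact_mod_cast hN
    have he : Real.exp (-t) = Real.exp (-(t / N)) ^ N := by
      rw [← Real.exp_nat_mul]
      congr 1
      field_simp
    rw [he, ← mul_pow, erlangTail, sub_mul, ← Real.exp_add, add_neg_cancel, Real.exp_zero]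
  rw [hval] at h3
  simpa only [mul_assoc] using h3

lemma completeWordRatio_nonneg (m N n : ℕ) : 0 ≤ completeWordRatio m N n := by
  unfold completeWordRatio; positivity

lemma completeWordRatio_le_one (m N n : ℕ) : completeWordRatio m N n ≤ 1 := by
  refine div_le_one_of_le₀ ?_ (by positivity)
  have := Finset.card_filter_le (Finset.univ : Finset (Fin n → Fin N))
    (fun f => ∀ c, m ≤ (Finset.univ.filter (fun i => f i = c)).card)
  rw [Finset.card_univ, Fintype.card_fun, Fintype.card_fin, Fintype.card_fin] at this
  exact_mod_cast this

lemma hasSum_one_sub_completeWordRatio (m N : ℕ) (hN : N ≠ 0) {t : ℝ} (ht : 0 ≤ t) :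
    HasSum (fun n : ℕ =>
      (1 - completeWordRatio m N n) * (t ^ n / (n.factorial : ℝ) * Real.exp (-t)))
      (1 - (1 - erlangTail m (t / N)) ^ N) := by
  have h1 : HasSum (fun k : ℕ => t ^ k / (k.factorial : ℝ) * Real.exp (-t)) 1 := by
    have : HasSum (fun k : ℕ => t ^ k / (k.factorial : ℝ)) (Real.exp t) := by
      rw [Real.exp_eq_exp_ℝ]
      exact NormedSpace.expSeries_div_hasSum_exp t
    have h := this.mul_right (Real.exp (-t))
    rwa [← Real.exp_add, add_neg_cancel, Real.exp_zero] at h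
  refine (h1.sub (hasSum_completeWordRatio m N hN ht)).congr_fun fun n => ?_
  ring

/-- Weighted sums of the tail probabilities as moments of the maximum of Erlang variables. -/
lemma tsum_one_sub_completeWordRatio (j m N : ℕ) (hN : N ≠ 0) :
    ∑' n : ℕ, ENNReal.ofReal ((1 - completeWordRatio m N n) *
        (((n + j).factorial : ℝ) / (n.factorial : ℝ))) =
      ENNReal.ofReal ((N : ℝ) ^ (j + 1) * erlangMaxMoment j m N) := by
  have hN' : (0 : ℝ) < N := by exact_mod_cast Nat.pos_of_ne_zero hN
  -- The factor (n + j)! is written as a Gamma integral; the sum and the integral are then exchanged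
  -- by Tonelli, and the sum is evaluated by Poissonization.
  have hterm : ∀ n : ℕ, ENNReal.ofReal ((1 - completeWordRatio m N n) *
      (((n + j).factorial : ℝ) / (n.factorial : ℝ))) =
      ∫⁻ t in Set.Ioi (0 : ℝ), ENNReal.ofReal (t ^ j *
        ((1 - completeWordRatio m N n) * (t ^ n / (n.factorial : ℝ) * Real.exp (-t)))) := by
    intro n
    have hc := completeWordRatio_le_one m N n
    have he : ∀ t : ℝ, t ^ j *
        ((1 - completeWordRatio m N n) * (t ^ n / (n.factorial : ℝ) * Real.exp (-t))) =
        ((1 - completeWordRatio m N n) / (n.factorial : ℝ)) * (t ^ (n + j) * Real.exp (-t)) := by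
      intro t
      rw [pow_add]
      ring
    simp_rw [he]
    rw [← ofReal_integral_eq_lintegral_ofReal ((integrableOn_pow_mul_exp_neg (n + j)).const_mul _),
      integral_const_mul, integral_pow_mul_exp_neg]
    · congr 1
      ring
    · refine (ae_restrict_iff' measurableSet_Ioi).mpr (ae_of_all _ fun y hy => ?_)
      have hy' : (0 : ℝ) ≤ y := le_of_lt hy
      have : 0 ≤ 1 - completeWordRatio m N n := by linarith
      simp only [Pi.zero_apply]
      positivity
  simp_rw [hterm]
  rw [← lintegral_tsum fun n => by fun_prop]
  have hsum : ∫⁻ t in Set.Ioi (0 : ℝ), ∑' n : ℕ, ENNReal.ofReal (t ^ j *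
        ((1 - completeWordRatio m N n) * (t ^ n / (n.factorial : ℝ) * Real.exp (-t)))) =
      ∫⁻ t in Set.Ioi (0 : ℝ), ENNReal.ofReal (t ^ j * (1 - (1 - erlangTail m (t / N)) ^ N)) := by
    refine setLIntegral_congr_fun measurableSet_Ioi fun t ht => ?_
    have ht' : (0 : ℝ) ≤ t := le_of_lt ht
    have h := (hasSum_one_sub_completeWordRatio m N hN ht').mul_left (t ^ j)
    rw [← h.tsum_eq, ENNReal.ofReal_tsum_of_nonneg _ h.summable]
    intro n
    have hc := completeWordRatio_le_one m N n
    have : 0 ≤ 1 - completeWordRatio m N n := by linarith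
    positivity
  rw [hsum]
  -- Prepares the substitution t = N y: t^j contributes N^j and dt one more factor N.
  have hcomp : ∀ t : ℝ, t ^ j * (1 - (1 - erlangTail m (t / N)) ^ N) =
      (N : ℝ) ^ j * (((N : ℝ)⁻¹ * t) ^ j * (1 - (1 - erlangTail m ((N : ℝ)⁻¹ * t)) ^ N)) := by
    intro t
    rw [mul_pow, inv_pow, inv_mul_eq_div (N : ℝ) t]
    field_simp
  have hint : IntegrableOn (fun t : ℝ => (N : ℝ) ^ j *
      (((N : ℝ)⁻¹ * t) ^ j * (1 - (1 - erlangTail m ((N : ℝ)⁻¹ * t)) ^ N))) (Set.Ioi 0) := by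
    refine Integrable.const_mul ?_ _
    have := (integrableOn_Ioi_comp_mul_left_iff
      (fun y : ℝ => y ^ j * (1 - (1 - erlangTail m y) ^ N)) 0 (inv_pos.mpr hN')).mpr
    rw [mul_zero] at this
    exact this (integrableOn_erlangMaxMoment j m N)
  simp_rw [hcomp]
  rw [← ofReal_integral_eq_lintegral_ofReal hint, integral_const_mul,
    integral_comp_mul_left_Ioi (fun y : ℝ => y ^ j * (1 - (1 - erlangTail m y) ^ N)) 0
      (inv_pos.mpr hN'), inv_inv, mul_zero, smul_eq_mul, pow_succ, mul_assoc]
  · rfl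
  · refine (ae_restrict_iff' measurableSet_Ioi).mpr (ae_of_all _ fun y hy => ?_)
    have hy' : (0 : ℝ) ≤ (N : ℝ)⁻¹ * y := mul_nonneg (by positivity) (le_of_lt hy)
    have := one_sub_one_sub_erlangTail_pow_nonneg m N hy'
    simp only [Pi.zero_apply]
    positivity

/-! ### From words to random draws: tails and moments of the collection time. -/

lemma collectionTime_le_iff {C : Type*} [DecidableEq C] (m : ℕ) (x : ℕ → C) (n : ℕ) :
    collectionTime m x ≤ n ↔
      ∀ c : C, m ≤ ((Finset.range n).filter (fun i => x i = c)).card := by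
  constructor
  · intro h
    by_contra hn
    have h1 : ((n + 1 : ℕ) : ℕ∞) ≤ collectionTime m x := by
      refine le_iInf₂ fun k hk => ?_
      rw [Nat.cast_le, Nat.succ_le_iff]
      by_contra hkn
      exact hn fun c => (hk c).trans
        (Finset.card_le_card (Finset.filter_subset_filter _ (Finset.range_mono (not_lt.mp hkn))))
    have h2 := h1.trans h
    rw [Nat.cast_le] at h2
    omega
  · intro h
    exact iInf₂_le n h

lemma drawTime_le_iff {Ω : Type*} {N : ℕ+} (m : ℕ) (X : ℕ → Ω → Fin N) (ω : Ω) (n : ℕ) :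
    drawTime m X ω ≤ n ↔ (fun i : Fin n => X i ω) ∈ Finset.univ.filter
      (fun f : Fin n → Fin N => ∀ c, m ≤ (Finset.univ.filter (fun i => f i = c)).card) := by
  rw [drawTime, collectionTime_le_iff]
  simp only [Finset.mem_filter, Finset.mem_univ, true_and]
  refine forall_congr' fun c => ?_
  rw [Finset.card_filter, Finset.card_filter, Finset.sum_range]

section Draws

variable {Ω : Type*} [MeasurableSpace Ω] {μ : Measure Ω} {N : ℕ+} {X : ℕ → Ω → Fin N}

lemma IsUniformDraws.measure_eq_word (hX : IsUniformDraws μ N X) (n : ℕ) (f : Fin n → Fin N) :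
    μ {ω | (fun i : Fin n => X i ω) = f} = ((N : ℕ) : ENNReal)⁻¹ ^ n := by
  have h := (hX.indep.precomp (g := fun i : Fin n => (i : ℕ)) Fin.val_injective)
  have h2 := (iIndepFun_iff_measure_inter_preimage_eq_mul.mp h) Finset.univ
    (sets := fun i => {f i}) (fun i _ => measurableSet_singleton _)
  have h3 : {ω | (fun i : Fin n => X i ω) = f} =
      ⋂ i ∈ (Finset.univ : Finset (Fin n)), (X i) ⁻¹' {f i} := by
    ext ω
    simp [funext_iff]
  have h4 : ∀ i : Fin n, μ (X i ⁻¹' {f i}) = ((N : ℕ) : ENNReal)⁻¹ := fun i =>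
    hX.uniform i (f i)
  rw [h3]
  refine h2.trans ?_
  simp [h4]

lemma IsUniformDraws.measurable_word (hX : IsUniformDraws μ N X) (n : ℕ) :
    Measurable fun ω => fun i : Fin n => X i ω :=
  measurable_pi_lambda _ fun i => hX.measurable i

lemma IsUniformDraws.measurableSet_drawTime_le (hX : IsUniformDraws μ N X) (m n : ℕ) :
    MeasurableSet {ω | drawTime m X ω ≤ n} := by
  simp_rw [drawTime_le_iff]
  exact hX.measurable_word n (Finset.measurableSet _)

lemma IsUniformDraws.measure_drawTime_le (hX : IsUniformDraws μ N X) (m n : ℕ) :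
    μ {ω | drawTime m X ω ≤ n} = ENNReal.ofReal (completeWordRatio m N n) := by
  have h : {ω | drawTime m X ω ≤ n} = ⋃ f ∈ Finset.univ.filter
      (fun f : Fin n → Fin N => ∀ c, m ≤ (Finset.univ.filter (fun i => f i = c)).card),
        {ω | (fun i : Fin n => X i ω) = f} := by
    ext ω
    simp only [Set.mem_ofPred_eq, drawTime_le_iff, Set.mem_iUnion, exists_prop,
      exists_eq_right']
  rw [h, measure_biUnion_finset]
  · simp_rw [hX.measure_eq_word]
    rw [Finset.sum_const, nsmul_eq_mul, completeWordRatio, ENNReal.ofReal_div_of_pos (by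
      have := N.pos; positivity), ENNReal.ofReal_natCast, ENNReal.ofReal_pow (by positivity),
      ENNReal.ofReal_natCast, ← ENNReal.inv_pow, div_eq_mul_inv]
  · intro f _ g _ hfg
    refine Set.disjoint_left.mpr fun ω hf hg => hfg ?_
    exact (show (fun i : Fin n => X i ω) = f from hf).symm.trans hg
  · exact fun f _ => hX.measurable_word n (measurableSet_singleton f)

lemma IsUniformDraws.measure_lt_drawTime [IsProbabilityMeasure μ] (hX : IsUniformDraws μ N X)
    (m n : ℕ) : μ {ω | drawTime m X ω ≤ n}ᶜ = ENNReal.ofReal (1 - completeWordRatio m N n) := by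
  rw [prob_compl_eq_one_sub (hX.measurableSet_drawTime_le m n), hX.measure_drawTime_le,
    ENNReal.ofReal_sub _ (completeWordRatio_nonneg _ _ _), ENNReal.ofReal_one]

lemma IsUniformDraws.tsum_measure_lt_drawTime [IsProbabilityMeasure μ]
    (hX : IsUniformDraws μ N X) (m j : ℕ) :
    ∑' n : ℕ, ENNReal.ofReal (((n + j).factorial : ℝ) / (n.factorial : ℝ)) *
        μ {ω | drawTime m X ω ≤ n}ᶜ =
      ENNReal.ofReal (((N : ℕ) : ℝ) ^ (j + 1) * erlangMaxMoment j m N) := by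
  rw [← tsum_one_sub_completeWordRatio j m N N.ne_zero]
  refine tsum_congr fun n => ?_
  rw [hX.measure_lt_drawTime, mul_comm, ENNReal.ofReal_mul]
  linarith [completeWordRatio_le_one m N n]

lemma IsUniformDraws.ae_drawTime_lt_top [IsProbabilityMeasure μ] (hX : IsUniformDraws μ N X)
    (m : ℕ) : ∀ᵐ ω ∂μ, drawTime m X ω < ⊤ := by
  have h := hX.tsum_measure_lt_drawTime m 0
  have h1 : ∀ n : ℕ, ((n.factorial : ℝ) / (n.factorial : ℝ)) = 1 := fun n =>
    div_self (by positivity)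
  simp only [add_zero, h1, ENNReal.ofReal_one, one_mul] at h
  have h2 := ENNReal.tendsto_atTop_zero_of_tsum_ne_top (h ▸ ENNReal.ofReal_ne_top)
  -- The tails are summable, hence tend to 0, and each of them bounds the probability that the time
  -- is `⊤`.
  refine le_antisymm (ge_of_tendsto' h2 fun n => measure_mono fun ω hω => ?_) bot_le
  have hω' : drawTime m X ω = ⊤ := by simpa using hω
  simp [hω']

lemma tsum_ite_lt (w : ℕ → ENNReal) (k : ℕ) :
    ∑' n : ℕ, (if n < k then w n else 0) = ∑ n ∈ Finset.range k, w n := by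
  rw [tsum_eq_sum (s := Finset.range k) fun n hn => if_neg (by simpa using hn)]
  exact Finset.sum_congr rfl fun n hn => if_pos (Finset.mem_range.mp hn)

/-- Layer-cake formula: the sum of w n over n < T is ∑ w n 1_{T > n}. It is only an almost
everywhere identity, since `toNat` sends `⊤` to 0. -/
lemma IsUniformDraws.lintegral_sum_range_drawTime [IsProbabilityMeasure μ]
    (hX : IsUniformDraws μ N X) (m : ℕ) (w : ℕ → ENNReal) :
    AEMeasurable (fun ω => ∑ n ∈ Finset.range (drawTime m X ω).toNat, w n) μ ∧
    ∫⁻ ω, ∑ n ∈ Finset.range (drawTime m X ω).toNat, w n ∂μ =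
      ∑' n : ℕ, w n * μ {ω | drawTime m X ω ≤ n}ᶜ := by
  have hmeas : ∀ n : ℕ, Measurable ({ω | drawTime m X ω ≤ n}ᶜ.indicator fun _ => w n) :=
    fun n => measurable_const.indicator (hX.measurableSet_drawTime_le m n).compl
  have hae : (fun ω => ∑ n ∈ Finset.range (drawTime m X ω).toNat, w n) =ᵐ[μ]
      fun ω => ∑' n : ℕ, {ω | drawTime m X ω ≤ n}ᶜ.indicator (fun _ => w n) ω := by
    filter_upwards [hX.ae_drawTime_lt_top m] with ω hω
    rw [← tsum_ite_lt]
    refine tsum_congr fun n => ?_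
    obtain ⟨k, hk⟩ := ENat.ne_top_iff_exists.mp hω.ne
    simp [Set.indicator_apply, ← hk]
  refine ⟨(Measurable.tsum hmeas).aemeasurable.congr hae.symm, ?_⟩
  rw [lintegral_congr_ae hae, lintegral_tsum fun n => (hmeas n).aemeasurable]
  refine tsum_congr fun n => ?_
  rw [lintegral_indicator_const (hX.measurableSet_drawTime_le m n).compl]

lemma sum_range_ofReal_succ_factorial_div (k : ℕ) :
    ∑ n ∈ Finset.range k, ENNReal.ofReal (((n + 1).factorial : ℝ) / (n.factorial : ℝ)) =
      ENNReal.ofReal ((k : ℝ) * (k + 1) / 2) := by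
  rw [← ENNReal.ofReal_sum_of_nonneg fun n _ => by positivity]
  congr 1
  induction k with
  | zero => simp
  | succ k ih =>
    rw [Finset.sum_range_succ, ih, Nat.factorial_succ]
    have : (k.factorial : ℝ) ≠ 0 := by positivity
    push_cast
    field_simp
    ring

/-- The first two moments of the collection time, in terms of the maximum of Erlang variables. -/
lemma IsUniformDraws.moments_drawTimeReal [IsProbabilityMeasure μ] (hX : IsUniformDraws μ N X)
    (m : ℕ) :
    MemLp (drawTimeReal m X) 2 μ ∧
    ∫ ω, drawTimeReal m X ω ∂μ = (N : ℕ) * erlangMaxMoment 0 m N ∧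
    ∫ ω, drawTimeReal m X ω ^ 2 ∂μ =
      2 * ((N : ℕ) : ℝ) ^ 2 * erlangMaxMoment 1 m N - (N : ℕ) * erlangMaxMoment 0 m N := by
  have hmom : ∀ j, 0 ≤ erlangMaxMoment j m N := fun j =>
    setIntegral_nonneg measurableSet_Ioi fun y hy => mul_nonneg
      (pow_nonneg (le_of_lt hy) _) (one_sub_one_sub_erlangTail_pow_nonneg _ _ (le_of_lt hy))
  have h0 := hX.lintegral_sum_range_drawTime m (fun _ => 1)
  have h1 := hX.lintegral_sum_range_drawTime m
    (fun n => ENNReal.ofReal (((n + 1).factorial : ℝ) / (n.factorial : ℝ)))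
  have hf : ∀ n : ℕ, ((n.factorial : ℝ) / (n.factorial : ℝ)) = 1 := fun n =>
    div_self (by positivity)
  have e0 := hX.tsum_measure_lt_drawTime m 0
  simp only [add_zero, hf, ENNReal.ofReal_one, zero_add, pow_one] at e0
  rw [e0] at h0
  rw [hX.tsum_measure_lt_drawTime m 1] at h1
  simp only [sum_range_ofReal_succ_factorial_div] at h1
  have hr : ∀ ω, ∑ n ∈ Finset.range (drawTime m X ω).toNat, (1 : ENNReal) =
      ENNReal.ofReal (drawTimeReal m X ω) := by
    intro ω
    simp [drawTimeReal]
  simp only [hr] at h0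
  have hT : ∀ ω, 0 ≤ drawTimeReal m X ω := fun ω => Nat.cast_nonneg _
  have m0 : AEStronglyMeasurable (drawTimeReal m X) μ := by
    refine (h0.1.ennreal_toReal.congr (ae_of_all _ fun ω => ?_)).aestronglyMeasurable
    exact ENNReal.toReal_ofReal (hT ω)
  have m1 : AEStronglyMeasurable (fun ω => drawTimeReal m X ω * (drawTimeReal m X ω + 1) / 2) μ :=
    by fun_prop
  have p1 : ∀ ω, 0 ≤ drawTimeReal m X ω * (drawTimeReal m X ω + 1) / 2 := fun ω => by
    have := hT ω
    positivity
  change _ ∧ ∫⁻ ω, ENNReal.ofReal (drawTimeReal m X ω * (drawTimeReal m X ω + 1) / 2) ∂μ = _ at h1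
  -- Integrability comes from the exact value of the `lintegral`: it is an `ENNReal.ofReal`, hence
  -- finite.
  have i0 : Integrable (drawTimeReal m X) μ :=
    (lintegral_ofReal_ne_top_iff_integrable m0 (ae_of_all _ hT)).mp (h0.2 ▸ ENNReal.ofReal_ne_top)
  have i1 : Integrable (fun ω => drawTimeReal m X ω * (drawTimeReal m X ω + 1) / 2) μ :=
    (lintegral_ofReal_ne_top_iff_integrable m1 (ae_of_all _ p1)).mp (h1.2 ▸ ENNReal.ofReal_ne_top)
  have v0 : ∫ ω, drawTimeReal m X ω ∂μ = (N : ℕ) * erlangMaxMoment 0 m N := by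
    rw [integral_eq_lintegral_of_nonneg_ae (ae_of_all _ hT) m0, h0.2,
      ENNReal.toReal_ofReal (mul_nonneg (by positivity) (hmom 0))]
  have v1 : ∫ ω, drawTimeReal m X ω * (drawTimeReal m X ω + 1) / 2 ∂μ =
      ((N : ℕ) : ℝ) ^ 2 * erlangMaxMoment 1 m N := by
    rw [integral_eq_lintegral_of_nonneg_ae (ae_of_all _ p1) m1, h1.2,
      ENNReal.toReal_ofReal (mul_nonneg (by positivity) (hmom 1))]
  have hsq : (fun ω => drawTimeReal m X ω ^ 2) =
      fun ω => 2 * (drawTimeReal m X ω * (drawTimeReal m X ω + 1) / 2) - drawTimeReal m X ω := by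
    ext ω
    ring
  refine ⟨(memLp_two_iff_integrable_sq m0).mpr ?_, v0, ?_⟩
  · rw [hsq]
    exact (i1.const_mul 2).sub i0
  · rw [hsq, integral_sub (i1.const_mul 2) i0, integral_const_mul, v0, v1]
    ring

lemma IsUniformDraws.variance_drawTimeReal [IsProbabilityMeasure μ] (hX : IsUniformDraws μ N X)
    (m : ℕ) :
    variance (drawTimeReal m X) μ =
      ((N : ℕ) : ℝ) ^ 2 * (2 * erlangMaxMoment 1 m N - erlangMaxMoment 0 m N ^ 2) -
        (N : ℕ) * erlangMaxMoment 0 m N := by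
  obtain ⟨h, h1, h2⟩ := hX.moments_drawTimeReal m
  rw [variance_eq_sub h, h1]
  simp only [Pi.pow_apply]
  rw [h2]
  ring

end Draws

/-! ### Conclusion. -/

/-- The exact variance contains the correction -N M_0; this makes it negligible against N². -/
lemma tendsto_erlangMaxMoment_zero_div {m : ℕ} (hm : 1 ≤ m) :
    Tendsto (fun N : ℕ => erlangMaxMoment 0 m N / N) atTop (nhds 0) := by
  have hlog : Tendsto (fun N : ℕ => Real.log (N : ℝ) / N) atTop (nhds 0) :=
    Real.isLittleO_log_id_atTop.tendsto_div_nhds_zero.comp tendsto_natCast_atTop_atTop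
  have h1 := ((tendsto_erlangCentre_add_div_log m 0).mul hlog).add
    ((tendsto_erlangMaxMoment_zero_sub hm).mul tendsto_inv_atTop_nhds_zero_nat)
  simp only [mul_zero, add_zero] at h1
  refine h1.congr' ?_
  filter_upwards [tendsto_log_natCast_atTop.eventually_gt_atTop 0] with N hN
  field_simp
  ring

theorem mainTheorem4 (m : ℕ) (hm : 1 ≤ m)
    {Ω : ℕ+ → Type*} [∀ N, MeasurableSpace (Ω N)]
    (μ : ∀ N : ℕ+, Measure (Ω N)) [∀ N, IsProbabilityMeasure (μ N)]
    (X : ∀ N : ℕ+, ℕ → Ω N → Fin N) (hX : ∀ N, IsUniformDraws (μ N) N (X N)) :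
    (∀ N : ℕ+, (∀ᵐ ω ∂(μ N), drawTime m (X N) ω < ⊤) ∧
      MemLp (drawTimeReal m (X N)) 2 (μ N)) ∧
    (fun N : ℕ+ => variance (drawTimeReal m (X N)) (μ N)) ~[atTop]
      (fun N : ℕ+ => Real.pi ^ 2 / 6 * ((N : ℕ) : ℝ) ^ 2) ∧
    (fun N : ℕ+ => (∫ ω, drawTimeReal m (X N) ω ∂(μ N)) -
        (((N : ℕ) : ℝ) * Real.log ((N : ℕ) : ℝ) +
          ((m : ℝ) - 1) * ((N : ℕ) : ℝ) * Real.log (Real.log ((N : ℕ) : ℝ)) +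
          ((N : ℕ) : ℝ) *
            (Real.eulerMascheroniConstant - Real.log ((Nat.factorial (m - 1) : ℕ) : ℝ))))
      =o[atTop] (fun N : ℕ+ => ((N : ℕ) : ℝ)) := by
  have hN : ∀ N : ℕ+, ((N : ℕ) : ℝ) ≠ 0 := fun N => Nat.cast_ne_zero.mpr N.ne_zero
  refine ⟨fun N => ⟨(hX N).ae_drawTime_lt_top m, ((hX N).moments_drawTimeReal m).1⟩, ?_, ?_⟩
  · have h : Tendsto (fun N : ℕ => ((2 * erlangMaxMoment 1 m N - erlangMaxMoment 0 m N ^ 2) -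
        erlangMaxMoment 0 m N / N) / (Real.pi ^ 2 / 6)) atTop (nhds 1) := by
      have := ((tendsto_two_mul_erlangMaxMoment_one_sub hm).sub
        (tendsto_erlangMaxMoment_zero_div hm)).div_const (Real.pi ^ 2 / 6)
      rwa [sub_zero, div_self (by positivity)] at this
    refine isEquivalent_of_tendsto_one ((PNat.tendsto_comp_val_iff.mpr h).congr fun N => ?_)
    rw [Pi.div_apply, (hX N).variance_drawTimeReal m]
    have := hN N
    field_simp
  · rw [isLittleO_iff_tendsto fun N h => absurd h (hN N)]
    have h := (tendsto_erlangMaxMoment_zero_sub hm).sub_const Real.eulerMascheroniConstant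
    rw [sub_self] at h
    refine (PNat.tendsto_comp_val_iff.mpr h).congr fun N => ?_
    rw [((hX N).moments_drawTimeReal m).2.1, erlangCentre]
    have := hN N
    field_simp
    ring
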